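/- **Conventions.** Let $T$ be a complete first-order theory in a language $L$. Let $\mathfrak C\models T$ be a monster model: $\mathfrak C$ is $\kappa$-saturated for some uncountable strong limit cardinal $\kappa>|L|$. Sets of size $<\kappa$ are called small. A subset of $\mathfrak C^m$ ($m<\omega$) is *type-definable* if it is the set of realizations of a set of formulas with parameters from a small set. A *type-definable group* is a group whose underlying set $G\subseteq\mathfrak C^m$ and the graph of whose multiplication are type-definable. For subgroups $H\le K$ of $G$, the index $[K:H]$ is *bounded*, written $[K:H]<\infty$, if it is $<\kappa$. An *inp-pattern of depth $\lambda$* consists of formulas $\varphi_\alpha(x,y_\alpha)$, parameters $(a_{\alpha,i})_{i<\omega}$ and $k_\alpha<\omega$ for $\alpha<\lambda$, such that for every $\alpha<\lambda$ any $k_\alpha$ of the formulas $\varphi_\alpha(x,a_{\alpha,i})$, $i<\omega$ (with distinct indices $i$), are jointly inconsistent, and $\{\varphi_\alpha(x,a_{\alpha,f(\alpha)}):\alpha<\lambda\}$ is consistent for every $f:\lambda\to\omega$. The theory $T$ is *strong* if there is no inp-pattern of infinite depth in models of $T$ with $x$ a single variable. It is *of finite burden* if there is $b<\omega$ such that every inp-pattern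 in models of $T$ with $x$ a single variable has depth at most $b$. **Proposition.** Let $G$ be a type-definable group and, for $i<\omega$, let $G_i\le G$ be a type-definable normal subgroup of $G$. 1. If $T$ is strong, then there is some $i_0<\omega$ such that $\left[\bigcap_{i\neq i_0}G_i:\bigcap_{i<\omega}G_i\right]<\infty$. 2. If $T$ is of finite burden, then there are some $n<\omega$ and $i_0<n$ such that $\left[\bigcap_{i<n,\,i\neq i_0}G_i:\bigcap_{i<n}G_i\right]<\infty$ (an empty intersection is $G$). -/

import Mathlib

open FirstOrder Cardinal

universe u v w

namespace FirstOrder.Language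

/-- A set of tuples in `M` is type-definable (over a small set, where small means of size `< κ`) if
it is the set of realizations of some set of formulas with parameters in a small `A ⊆ M`. -/
def IsTypeDefinable (L : Language.{u, v}) {M : Type w} [L.Structure M] (κ : Cardinal.{w})
    {α : Type} (S : Set (α → M)) : Prop :=
  ∃ A : Set M, #A < κ ∧ ∃ p : Set (L[[A]].Formula α), S = {x | ∀ φ ∈ p, φ.Realize x}

/-- `κ`-saturation: every finitely satisfiable set of formulas in finitely many variables with
parameters from a set of size `< κ` is realized. -/
def IsSaturated (L : Language.{u, v}) (M : Type w) [L.Structure M] (κ : Cardinal.{w}) : Prop :=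
  ∀ A : Set M, #A < κ → ∀ (n : ℕ) (p : Set (L[[A]].Formula (Fin n))),
    (∀ s : Finset (L[[A]].Formula (Fin n)), (s : Set (L[[A]].Formula (Fin n))) ⊆ p →
      ∃ x : Fin n → M, ∀ φ ∈ s, φ.Realize x) →
    ∃ x : Fin n → M, ∀ φ ∈ p, φ.Realize x

/-- `M` is a monster model with respect to `κ`: `κ` is an uncountable strong limit cardinal greater
than the size of the language, and `M` is `κ`-saturated. (Strong `κ`-homogeneity, which is often
also demanded of a monster model, is not required here, so this notion is the more general one.)
Small means of size `< κ`, bounded means `< κ`. -/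
structure IsMonster (L : Language.{u, v}) (M : Type w) [L.Structure M] (κ : Cardinal.{w}) :
    Prop where
  isStrongLimit : κ.IsStrongLimit
  aleph0_lt : ℵ₀ < κ
  card_lt : Cardinal.lift.{w} L.card < Cardinal.lift.{max u v} κ
  isSaturated : IsSaturated L M κ

/-- A group whose underlying set is a set `G` of `n`-tuples is a type-definable group if `G` and the
graph of the multiplication are type-definable. (In a monster model this is the same as demanding
that `G` is type-definable and the multiplication is the restriction to `G` of a definable relation,
by compactness.) -/
structure IsTypeDefinableGroup (L : Language.{u, v}) {M : Type w} [L.Structure M]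
    (κ : Cardinal.{w}) {n : ℕ} (G : Set (Fin n → M)) [Group G] : Prop where
  carrier : IsTypeDefinable L κ G
  graph_mul : IsTypeDefinable L κ
    {x : Fin n ⊕ Fin n ⊕ Fin n → M | ∃ a b : G,
      x = Sum.elim (a : Fin n → M) (Sum.elim (b : Fin n → M) ((a * b : G) : Fin n → M))}

/-- A subgroup of a group of `n`-tuples is type-definable if its underlying set of tuples is. -/
def IsTypeDefinableSubgroup (L : Language.{u, v}) {M : Type w} [L.Structure M]
    (κ : Cardinal.{w}) {n : ℕ} {G : Set (Fin n → M)} [Group G] (H : Subgroup G) : Prop :=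
  IsTypeDefinable L κ ((fun g : G => (g : Fin n → M)) '' (H : Set G))

/-- For subgroups `H ≤ K`: the index `[K : H]`, as a cardinal, is bounded, i.e. `< κ`. -/
def BoundedIndex {G : Type w} [Group G] (κ : Cardinal.{w}) (K H : Subgroup G) : Prop :=
  #(K ⧸ H.subgroupOf K) < κ

/-- An inp-pattern in the structure `N` whose rows are indexed by `ι`, with `|x| = n`: formulas
`φ a (x, y)`, rows of parameters `param a i`, `i < ω`, and numbers `k a`, such that each row is
`k a`-inconsistent (any `k a` formulas with distinct indices have no common solution) and each path
is consistent (finitely satisfiable in `N`). -/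
structure InpPattern (L : Language.{u, v}) (N : Type w) [L.Structure N] (n : ℕ) (ι : Type*) where
  len : ι → ℕ
  φ : ∀ a : ι, L.Formula (Fin n ⊕ Fin (len a))
  param : ∀ a : ι, ℕ → Fin (len a) → N
  k : ι → ℕ
  inconsistent : ∀ (a : ι) (s : Finset ℕ), s.card = k a →
    ¬ ∃ x : Fin n → N, ∀ i ∈ s, (φ a).Realize (Sum.elim x (param a i))
  consistent : ∀ (f : ι → ℕ) (s : Finset ι),
    ∃ x : Fin n → N, ∀ a ∈ s, (φ a).Realize (Sum.elim x (param a (f a)))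

namespace Theory

variable {L : Language.{u, v}}

/-- Some model of `T` has an inp-pattern of depth `κ` with `|x| = n`. -/
def HasInpPattern (T : L.Theory) (n : ℕ) (κ : Cardinal.{max u v}) : Prop :=
  ∃ (N : Theory.ModelType.{u, v, max u v} T) (ι : Type (max u v)),
    #ι = κ ∧ Nonempty (InpPattern L N n ι)

/-- The burden of `T` (the supremum of the depths of the inp-patterns with `x` a singleton) is
at most `κ`. -/
def BurdenLE (T : L.Theory) (κ : Cardinal.{max u v}) : Prop :=
  ∀ μ : Cardinal.{max u v}, T.HasInpPattern 1 μ → μ ≤ κ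

/-- For a limit cardinal `κ`: the burden of `T` is at most `κ₋`, the element of `Card*` just
below `κ` and above all the cardinals `< κ`. -/
def BurdenLEMinus (T : L.Theory) (κ : Cardinal.{max u v}) : Prop :=
  ∀ μ : Cardinal.{max u v}, T.HasInpPattern 1 μ → μ < κ

/-- `T` is strong: its burden is at most `(ℵ₀)₋`. -/
def IsStrong (T : L.Theory) : Prop := T.BurdenLEMinus ℵ₀

/-- `T` is of finite burden: its burden is at most some natural number. -/
def HasFiniteBurden (T : L.Theory) : Prop := ∃ n : ℕ, T.BurdenLE n

end Theory

end FirstOrder.Language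

/-!
Suppose that the conclusion fails for a family `(H i)`, and let `K i` be the intersection of the
other subgroups. Each `K i` then meets unboundedly many cosets of `H i`. Since `H i` is
type-definable, there is one formula `χ i (x, y)`, satisfied by all of `g * H i` when `y` is given
by `g`, for which infinitely many `g ∈ K i` yield pairwise disjoint sets: otherwise, for each
formula defining `H i`, finitely many elements of `K i` meet all the others, and counting the
resulting functions from formulas to `ℕ` bounds the index, because `κ` is a strong limit
(`exists_row`). Normality makes the
rows independent: a product of elements `g i ∈ K i` lies in all the cosets `g i * H i` at once
(`exists_mul_mem`). This is an inp-pattern in `n` variables with as many rows as there are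
subgroups (`hasInpArray_of_not_boundedIndex`).

It remains to pass from `n` variables to one, the submultiplicativity of burden. Take a pattern in
the variables `(y, z)`, `y` single, with rows indexed by `J × B`; by Ramsey and compactness its rows
can be taken mutually indiscernible (`exists_mutuallyIndiscernible_isInpArray`). One tries to pick
from each block `{j} × B` a row, such that some `y` makes all paths through the picked rows
consistent in `z`. If this succeeds, adding `y` to the parameters gives a pattern in `z` with rows
`J`. If it fails at the block `j`, then for every `b : B` compactness gives a formula `ψ b (y)` with
parameters in the picked rows, the unused blocks and the first entry of row `(j, b)`, such that `y`
cannot satisfy `ψ b` for many entries of that row; indiscernibility turns these formulas into a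
pattern in the single variable `y` with rows `B` (`IsFreeChoice.exists_insert_or`). Taking
`J = B = ℕ` for strong theories and finite `J`, `B` for burden at most `b`, induction on `n` shows
that there is no pattern in `n` variables with `ℕ`, respectively `(b + 1) ^ n`, rows.
-/

universe w'

/-! ### Ramsey's theorem -/

/-- Ramsey's theorem for increasing maps: a two-colouring of the maps `P → ℕ` that only looks at the
values on a finite set `D` is constant on the maps that embed `D` in order into a suitable infinite
subset of `H`. The subset consists of the minima of a decreasing sequence of sets, each homogeneous
for the colouring with the value at the least element of `D` fixed. -/
theorem exists_infinite_homogeneous {P : Type*} [LinearOrder P] (D : Finset P) :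
    ∀ c : (P → ℕ) → Prop, (∀ h h', (∀ p ∈ D, h p = h' p) → (c h ↔ c h')) →
    ∀ H : Set ℕ, H.Infinite → ∃ H' ⊆ H, H'.Infinite ∧
      ∀ h h' : P → ℕ, StrictMonoOn h D → (∀ p ∈ D, h p ∈ H') →
        StrictMonoOn h' D → (∀ p ∈ D, h' p ∈ H') → (c h ↔ c h') := by
  classical
  induction D using Finset.induction_on_min with
  | empty => exact fun c hc H hH => ⟨H, subset_rfl, hH, fun h h' _ _ _ _ => hc h h' (by simp)⟩
  | insert p₀ D hp₀ ih =>
    intro c hc H hH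
    have key : ∀ (n : ℕ) (K : {K : Set ℕ // K.Infinite}), ∃ K' : {K : Set ℕ // K.Infinite},
        K'.1 ⊆ K.1 ∩ Set.Ioi n ∧ ∀ h h' : P → ℕ, StrictMonoOn h D → (∀ p ∈ D, h p ∈ K'.1) →
          StrictMonoOn h' D → (∀ p ∈ D, h' p ∈ K'.1) →
          (c (Function.update h p₀ n) ↔ c (Function.update h' p₀ n)) := by
      intro n K
      obtain ⟨K', hK', hinf, hom⟩ := ih (fun h => c (Function.update h p₀ n))
        (fun h h' hh => hc _ _ fun p hp => by
          by_cases hpp : p = p₀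
          · subst hpp; simp
          · simpa [Function.update_of_ne hpp] using hh p (Finset.mem_of_mem_insert_of_ne hp hpp))
        (K.1 ∩ Set.Ioi n) (by
          have := K.2.sdiff (Set.finite_Iic n)
          rwa [Set.sdiff_eq, Set.compl_Iic] at this)
      exact ⟨⟨K', hinf⟩, hK', hom⟩
    choose next hnext hhom using key
    let S : ℕ → {K : Set ℕ // K.Infinite} := fun k =>
      Nat.rec ⟨H, hH⟩ (fun _ K => next (sInf K.1) K) k
    let n : ℕ → ℕ := fun k => sInf (S k).1
    have hS : ∀ k, (S (k + 1)).1 ⊆ (S k).1 ∩ Set.Ioi (n k) := fun k => hnext _ _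
    have hn : ∀ k, n k ∈ (S k).1 := fun k => Nat.sInf_mem (S k).2.nonempty
    have hanti : Antitone fun k => (S k).1 :=
      antitone_nat_of_succ_le fun k => (hS k).trans Set.inter_subset_left
    have hmono : StrictMono n := strictMono_nat_of_lt_succ fun k => (hS k (hn (k + 1))).2
    let v : ℕ → Prop := fun k => ∃ h : P → ℕ, StrictMonoOn h D ∧ (∀ p ∈ D, h p ∈ (S (k + 1)).1) ∧
      c (Function.update h p₀ (n k))
    -- one of the two colours occurs infinitely often
    obtain ⟨b, hb⟩ : ∃ b : Prop, {k | v k ↔ b}.Infinite := by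
      by_cases ht : {k | v k}.Infinite
      · exact ⟨True, by simpa using ht⟩
      · refine ⟨False, ?_⟩
        have := (Set.not_infinite.mp ht).infinite_compl
        simpa [Set.compl_def] using this
    refine ⟨n '' {k | v k ↔ b}, ?_, hb.image hmono.injective.injOn, ?_⟩
    · rintro _ ⟨k, -, rfl⟩
      exact hanti (Nat.zero_le k) (hn k)
    · have main : ∀ h : P → ℕ, StrictMonoOn h ↑(insert p₀ D) →
          (∀ p ∈ insert p₀ D, h p ∈ n '' {k | v k ↔ b}) → (c h ↔ b) := by
        intro h hh hmem
        obtain ⟨k, hk, hkp⟩ := hmem p₀ (Finset.mem_insert_self _ _)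
        have hD : StrictMonoOn h D := hh.mono (by simp)
        have hin : ∀ p ∈ D, h p ∈ (S (k + 1)).1 := by
          intro p hp
          obtain ⟨l, -, hl⟩ := hmem p (Finset.mem_insert_of_mem hp)
          have : n k < n l := by
            rw [hl, hkp]
            exact hh (by simp) (by simp [hp]) (hp₀ p hp)
          rw [← hl]
          exact hanti (Nat.succ_le_of_lt (hmono.lt_iff_lt.mp this)) (hn l)
        have hupd : Function.update h p₀ (n k) = h := by rw [hkp, Function.update_eq_self]
        rw [← (show v k ↔ b from hk)]
        constructor
        · intro hc'
          exact ⟨h, hD, hin, by rwa [hupd]⟩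
        · rintro ⟨h', hD', hin', hc'⟩
          rw [← hupd]
          exact (hhom _ _ h' h hD' hin' hD hin).1 hc'
      exact fun h h' h1 h2 h3 h4 => (main h h1 h2).trans (main h' h3 h4).symm

theorem exists_infinite_homogeneous_finset {P ι : Type*} [LinearOrder P] (D : ι → Finset P)
    (c : ι → (P → ℕ) → Prop) (hc : ∀ i h h', (∀ p ∈ D i, h p = h' p) → (c i h ↔ c i h'))
    (s : Finset ι) : ∃ H : Set ℕ, H.Infinite ∧ ∀ i ∈ s,
      ∀ h h' : P → ℕ, StrictMonoOn h (D i) → (∀ p ∈ D i, h p ∈ H) →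
        StrictMonoOn h' (D i) → (∀ p ∈ D i, h' p ∈ H) → (c i h ↔ c i h') := by
  classical
  induction s using Finset.induction_on with
  | empty => exact ⟨Set.univ, Set.infinite_univ, by simp⟩
  | insert i s _ ih =>
    obtain ⟨H, hH, hom⟩ := ih
    obtain ⟨H', hH', hinf, hom'⟩ := exists_infinite_homogeneous (D i) (c i) (hc i) H hH
    refine ⟨H', hinf, fun j hj => ?_⟩
    rcases Finset.mem_insert.mp hj with rfl | hj
    · exact hom'
    · exact fun h h' h1 h2 h3 h4 => hom j hj h h' h1 (fun p hp => hH' (h2 p hp)) h3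
        (fun p hp => hH' (h4 p hp))

/-! ### Compactness and inp-arrays -/

namespace FirstOrder.Language

variable {L : Language.{u, v}}

/-- The compactness theorem for formulas in possibly infinitely many free variables, which also moves
from a structure in an arbitrary universe to the universe used by `Theory.HasInpPattern`. -/
theorem Theory.exists_model_realize (T : L.Theory) {V : Type} (S : Set (L.Formula V))
    (M : Type w) [L.Structure M] [Nonempty M] [M ⊨ T]
    (h : ∀ s : Finset (L.Formula V), (s : Set (L.Formula V)) ⊆ S →
      ∃ v : V → M, ∀ φ ∈ s, φ.Realize v) :
    ∃ (N : Theory.ModelType.{u, v, max u v} T) (v : V → N), ∀ φ ∈ S, φ.Realize v := by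
  classical
  have hsat : (((L.lhomWithConstants V).onTheory T) ∪ Formula.equivSentence '' S).IsSatisfiable := by
    rw [Theory.isSatisfiable_iff_isFinitelySatisfiable]
    intro T₀ hT₀
    obtain ⟨v, hv⟩ := h ((T₀.image Formula.equivSentence.symm).filter (· ∈ S))
      fun φ hφ => (Finset.mem_filter.1 hφ).2
    let := constantsOn.structure v
    have : M ⊨ (T₀ : L[[V]].Theory) := by
      refine ⟨fun ψ hψ => ?_⟩
      rcases hT₀ hψ with hψT | ⟨φ, hφ, rfl⟩
      · exact ((LHom.onTheory_model _ T).2 inferInstance).realize_of_mem ψ hψT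
      · exact (Formula.realize_equivSentence M φ).2 (hv φ <|
          Finset.mem_filter.2 ⟨Finset.mem_image.2 ⟨_, hψ, _root_.Equiv.symm_apply_apply _ _⟩, hφ⟩)
    exact Theory.Model.isSatisfiable M
  obtain ⟨N⟩ := hsat
  let : L.Structure N := (L.lhomWithConstants V).reduct N
  have : (L.lhomWithConstants V).IsExpansionOn N := LHom.isExpansionOn_reduct _ _
  have : N ⊨ T := (LHom.onTheory_model (L.lhomWithConstants V) T).1
    (Theory.Model.mono N.is_model Set.subset_union_left)
  exact ⟨ModelType.of T N, fun a => (L.con a : N), fun φ hφ =>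
    (Formula.realize_equivSentence N φ).1
      (N.is_model.realize_of_mem _ (Or.inr ⟨φ, hφ, rfl⟩))⟩

/-- The array of parameters `a` makes the formulas `φ` and the numbers `k` an inp-pattern. In contrast
to `InpPattern`, the variables are indexed by any type `X` and the parameters by one type `W`, the
same for all rows and possibly infinite. -/
structure IsInpArray {ι X W : Type} {N : Type w} [L.Structure N] (φ : ι → L.Formula (X ⊕ W))
    (k : ι → ℕ) (a : ι → ℕ → W → N) : Prop where
  inconsistent : ∀ (α : ι) (s : Finset ℕ), s.card = k α →
    ¬ ∃ x : X → N, ∀ i ∈ s, (φ α).Realize (Sum.elim x (a α i))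
  consistent : ∀ (f : ι → ℕ) (s : Finset ι),
    ∃ x : X → N, ∀ α ∈ s, (φ α).Realize (Sum.elim x (a α (f α)))

/-- The formula in the entries of an array that says that the instances at the positions in `t` have a
common solution. -/
noncomputable def commonSolution {ι X W : Type} [Finite X] (φ : ι → L.Formula (X ⊕ W))
    (t : Finset (ι × ℕ)) : L.Formula (ι × ℕ × W) :=
  Formula.iExs X (Formula.iInf fun p : t =>
    (φ p.1.1).relabel (Sum.elim Sum.inr fun w => Sum.inl (p.1.1, p.1.2, w)))

theorem realize_commonSolution {ι X W : Type} [Finite X] {N : Type w} [L.Structure N]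
    (φ : ι → L.Formula (X ⊕ W)) (t : Finset (ι × ℕ)) (v : ι × ℕ × W → N) :
    (commonSolution φ t).Realize v ↔
      ∃ x : X → N, ∀ p ∈ t, (φ p.1).Realize (Sum.elim x fun w => v (p.1, p.2, w)) := by
  simp only [commonSolution, Formula.realize_iExs, Formula.realize_iInf, Formula.realize_relabel,
    Subtype.forall]
  refine exists_congr fun x => forall₂_congr fun p hp => ?_
  have : Sum.elim v x ∘ Sum.elim Sum.inr (fun w => Sum.inl (p.1, p.2, w)) =
      Sum.elim x fun w => v (p.1, p.2, w) := by
    ext (i | i) <;> rfl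
  rw [this]

section

variable {ι X W : Type} {N : Type w} [L.Structure N] {φ : ι → L.Formula (X ⊕ W)} {k : ι → ℕ}

theorem isInpArray_iff_commonSolution [Finite X] {v : ι × ℕ × W → N} :
    IsInpArray φ k (fun α i w => v (α, i, w)) ↔
      (∀ (α : ι) (s : Finset ℕ), s.card = k α →
        (commonSolution φ (s.map (Function.Embedding.sectR α ℕ))).not.Realize v) ∧
      ∀ (f : ι → ℕ) (s : Finset ι),
        (commonSolution φ (s.map ⟨fun α => (α, f α), fun _ _ h => congrArg Prod.fst h⟩)).Realize
          v := by
  simp only [Formula.realize_not, realize_commonSolution, Finset.forall_mem_map]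
  exact ⟨fun h => ⟨h.1, h.2⟩, fun h => ⟨h.1, h.2⟩⟩

theorem IsInpArray.comp_rows {a : ι → ℕ → W → N} (h : IsInpArray φ k a) {ι' : Type}
    {e : ι' → ι} (he : Function.Injective e) :
    IsInpArray (fun j => φ (e j)) (fun j => k (e j)) fun j => a (e j) where
  inconsistent j := h.inconsistent (e j)
  consistent f s := by
    obtain ⟨x, hx⟩ := h.consistent (Function.extend e f 0) (s.map ⟨e, he⟩)
    refine ⟨x, fun j hj => ?_⟩
    have := hx (e j) (Finset.mem_map_of_mem ⟨e, he⟩ hj)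
    rwa [he.extend_apply] at this

theorem IsInpArray.comp_columns {a : ι → ℕ → W → N} (h : IsInpArray φ k a) {σ : ι → ℕ → ℕ}
    (hσ : ∀ α, Function.Injective (σ α)) : IsInpArray φ k fun α i => a α (σ α i) where
  inconsistent α s hs := by
    rintro ⟨x, hx⟩
    refine h.inconsistent α (s.map ⟨σ α, hσ α⟩) (by simpa using hs) ⟨x, ?_⟩
    simpa using hx
  consistent f s := h.consistent (fun α => σ α (f α)) s

theorem IsInpArray.relabel_vars {Y : Type} {a : ι → ℕ → W → N} (h : IsInpArray φ k a)
    (e : X ≃ Y) : IsInpArray (fun α => (φ α).relabel (Sum.map e id)) k a where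
  inconsistent α s hs := by
    rintro ⟨y, hy⟩
    refine h.inconsistent α s hs ⟨y ∘ e, fun i hi => ?_⟩
    have := hy i hi
    rwa [Formula.realize_relabel, Sum.elim_comp_map] at this
  consistent f s := by
    obtain ⟨x, hx⟩ := h.consistent f s
    refine ⟨x ∘ e.symm, fun α hα => ?_⟩
    rw [Formula.realize_relabel, Sum.elim_comp_map]
    simpa [Function.comp_assoc] using hx α hα

end

/-- Formulas that have arrays of parameters with all finite approximations of the two conditions have
one satisfying them, in some model. The array may depend on the approximation. -/
theorem Theory.exists_isInpArray_of_finite {T : L.Theory} {M : Type w} [L.Structure M] [Nonempty M]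
    [M ⊨ T] {ι X W : Type} [Finite X] (φ : ι → L.Formula (X ⊕ W)) (k : ι → ℕ)
    (h : ∀ (F : Finset ι) (n : ℕ), ∃ a : ι → ℕ → W → M,
      (∀ α ∈ F, ∀ s ⊆ Finset.range n, s.card = k α →
        ¬ ∃ x : X → M, ∀ i ∈ s, (φ α).Realize (Sum.elim x (a α i))) ∧
      ∀ f : ι → ℕ, (∀ α, f α < n) →
        ∃ x : X → M, ∀ α ∈ F, (φ α).Realize (Sum.elim x (a α (f α)))) :
    ∃ (N : Theory.ModelType.{u, v, max u v} T) (a : ι → ℕ → W → N), IsInpArray φ k a := by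
  classical
  let S : Set (L.Formula (ι × ℕ × W)) :=
    {χ | ∃ (α : ι) (s : Finset ℕ), s.card = k α ∧
        χ = (commonSolution φ (s.map (Function.Embedding.sectR α ℕ))).not} ∪
      {χ | ∃ (f : ι → ℕ) (s : Finset ι), χ =
        commonSolution φ (s.map ⟨fun α => (α, f α), fun _ _ h => congrArg Prod.fst h⟩)}
  -- every formula of `S` is decided by a large enough finite part of the array
  have key : ∀ χ ∈ S, ∃ (F₀ : Finset ι) (n₀ : ℕ), ∀ (F : Finset ι) (n : ℕ), F₀ ⊆ F → n₀ ≤ n →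
      ∀ a : ι → ℕ → W → M, (∀ α ∈ F, ∀ s ⊆ Finset.range n, s.card = k α →
        ¬ ∃ x : X → M, ∀ i ∈ s, (φ α).Realize (Sum.elim x (a α i))) →
      (∀ f : ι → ℕ, (∀ α, f α < n) →
        ∃ x : X → M, ∀ α ∈ F, (φ α).Realize (Sum.elim x (a α (f α)))) →
      χ.Realize fun p => a p.1 p.2.1 p.2.2 := by
    rintro χ (⟨α, s, hs, rfl⟩ | ⟨f, s, rfl⟩)
    · refine ⟨{α}, s.sup id + 1, fun F n hF hn a h₁ h₂ => ?_⟩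
      rw [Formula.realize_not, realize_commonSolution]
      simp only [Finset.forall_mem_map]
      refine h₁ α (hF (by simp)) s (fun i hi => ?_) hs
      have : i ≤ s.sup id := Finset.le_sup (f := id) hi
      simp only [Finset.mem_range]; omega
    · refine ⟨s, s.sup f + 1, fun F n hF hn a h₁ h₂ => ?_⟩
      rw [realize_commonSolution]
      simp only [Finset.forall_mem_map]
      obtain ⟨x, hx⟩ := h₂ (fun α => if α ∈ s then f α else 0) fun α => by
        split_ifs with hα
        · have : f α ≤ s.sup f := Finset.le_sup hα
          omega
        · omega
      refine ⟨x, fun α hα => ?_⟩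
      have := hx α (hF hα)
      rwa [if_pos hα] at this
  choose! F₀ n₀ hkey using key
  obtain ⟨N, v, hv⟩ := T.exists_model_realize S M fun s hs => by
    obtain ⟨a, h₁, h₂⟩ := h (s.biUnion F₀) (s.sup n₀)
    exact ⟨_, fun χ hχ => hkey χ (hs hχ) _ _ (Finset.subset_biUnion_of_mem F₀ hχ)
      (Finset.le_sup hχ) a h₁ h₂⟩
  exact ⟨N, fun α i w => v (α, i, w), isInpArray_iff_commonSolution.2
    ⟨fun α s hs => hv _ (Or.inl ⟨α, s, hs, rfl⟩), fun f s => hv _ (Or.inr ⟨f, s, rfl⟩)⟩⟩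

/-- The rows of the array `a` are mutually indiscernible: no formula without parameters in the entries
of the array changes its truth value when the columns of each row are moved by a strictly increasing
map, which may differ from row to row. -/
def IsMutuallyIndiscernible (L : Language.{u, v}) {ι W : Type} {N : Type w} [L.Structure N]
    (a : ι → ℕ → W → N) : Prop :=
  ∀ (χ : L.Formula (ι × ℕ × W)) (σ : ι → ℕ → ℕ), (∀ α, StrictMono (σ α)) →
    (χ.Realize (fun p => a p.1 p.2.1 p.2.2) ↔ χ.Realize fun p => a p.1 (σ p.1 p.2.1) p.2.2)

theorem Formula.realize_congr_of_mem_freeVarFinset {α : Type} [DecidableEq α] {N : Type w}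
    [L.Structure N]
    (χ : L.Formula α) {v v' : α → N} (h : ∀ p ∈ χ.freeVarFinset, v p = v' p) :
    χ.Realize v ↔ χ.Realize v' := by
  have h₁ := BoundedFormula.realize_restrictFreeVar (φ := χ) (f := id)
    (v := fun a => v a) (xs := (default : Fin 0 → N)) v (fun _ => rfl)
  have h₂ := BoundedFormula.realize_restrictFreeVar (φ := χ) (f := id)
    (v := fun a => v a) (xs := (default : Fin 0 → N)) v' (fun p => h p p.2)
  exact h₁.symm.trans h₂

/-- Every inp-array with countably many rows can be replaced by a mutually indiscernible one. For a
finite set of formulas, the entries `(α, i)` with `i < n` are taken from the columns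
`e (n * r α + i)` of the given array, where `e` enumerates a set homogeneous for the formulas: this
places the rows in consecutive segments of one sequence, and segments of an indiscernible sequence
are mutually indiscernible. -/
theorem Theory.exists_mutuallyIndiscernible_isInpArray {T : L.Theory} {M : Type w} [L.Structure M]
    [Nonempty M] [M ⊨ T] {ι X W : Type} [Countable ι] [Finite X] {φ : ι → L.Formula (X ⊕ W)}
    {k : ι → ℕ} {a : ι → ℕ → W → M} (ha : IsInpArray φ k a) :
    ∃ (N : Theory.ModelType.{u, v, max u v} T) (b : ι → ℕ → W → N), IsInpArray φ k b ∧
      IsMutuallyIndiscernible L b := by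
  classical
  obtain ⟨r, hr⟩ := exists_injective_nat ι
  let S₁ : Set (L.Formula (ι × ℕ × W)) :=
    {χ | ∀ v : ι × ℕ × W → M, IsInpArray φ k (fun α i w => v (α, i, w)) → χ.Realize v}
  let S : Set (L.Formula (ι × ℕ × W)) := S₁ ∪ Set.range
    fun p : L.Formula (ι × ℕ × W) × {σ : ι → ℕ → ℕ // ∀ α, StrictMono (σ α)} =>
      p.1.iff (p.1.relabel fun q => (q.1, p.2.1 q.1 q.2.1, q.2.2))
  -- the positions of the entries that occur in a formula, ordered lexicographically
  let D : L.Formula (ι × ℕ × W) → Finset (ℕ ×ₗ ℕ) := fun χ =>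
    χ.freeVarFinset.image fun q => toLex (r q.1, q.2.1)
  let c : L.Formula (ι × ℕ × W) → (ℕ ×ₗ ℕ → ℕ) → Prop := fun χ h =>
    χ.Realize fun q => a q.1 (h (toLex (r q.1, q.2.1))) q.2.2
  have hc : ∀ χ h h', (∀ p ∈ D χ, h p = h' p) → (c χ h ↔ c χ h') := fun χ h h' hh =>
    χ.realize_congr_of_mem_freeVarFinset fun q hq => by
      rw [hh _ (Finset.mem_image_of_mem _ hq)]
  have hfin : ∀ P : Finset (L.Formula (ι × ℕ × W) × {σ : ι → ℕ → ℕ // ∀ α, StrictMono (σ α)}),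
      ∃ v : ι × ℕ × W → M, IsInpArray φ k (fun α i w => v (α, i, w)) ∧
        ∀ p ∈ P, (p.1.iff (p.1.relabel fun q => (q.1, p.2.1 q.1 q.2.1, q.2.2))).Realize v := by
    intro P
    obtain ⟨H, hH, hom⟩ := exists_infinite_homogeneous_finset D c hc (P.image Prod.fst)
    let e : ℕ → ℕ := Nat.nth (· ∈ H)
    have he : StrictMono e := Nat.nth_strictMono hH
    have heH : ∀ n, e n ∈ H := fun n => Nat.nth_mem_of_infinite hH n
    -- a bound for the columns that occur
    let n : ℕ := P.sup fun p => p.1.freeVarFinset.sup fun q => p.2.1 q.1 q.2.1 + 1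
    let h : ℕ ×ₗ ℕ → ℕ := fun p => e (n * (ofLex p).1 + (ofLex p).2)
    have hmono : ∀ (χ : L.Formula (ι × ℕ × W)) (τ : ℕ → ℕ → ℕ), (∀ i, StrictMono (τ i)) →
        (∀ q ∈ χ.freeVarFinset, τ (r q.1) q.2.1 < n) →
        StrictMonoOn (fun p : ℕ ×ₗ ℕ => h (toLex ((ofLex p).1, τ (ofLex p).1 (ofLex p).2)))
          (D χ) := by
      intro χ τ hτ hn p hp p' hp' hlt
      obtain ⟨q, hq, rfl⟩ := Finset.mem_image.1 (Finset.mem_coe.1 hp)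
      obtain ⟨q', hq', rfl⟩ := Finset.mem_image.1 (Finset.mem_coe.1 hp')
      refine he ?_
      simp only [ofLex_toLex]
      rcases Prod.Lex.toLex_lt_toLex.1 hlt with hlt | ⟨heq, hlt⟩
      · have h₁ := hn q hq
        have h₂ : n * (r q.1 + 1) ≤ n * r q'.1 := Nat.mul_le_mul_left n hlt
        rw [mul_add] at h₂
        omega
      · simp only at heq hlt
        have := hτ (r q.1) hlt
        rw [← heq]
        omega
    refine ⟨fun q => a q.1 (h (toLex (r q.1, q.2.1))) q.2.2, ?_, fun p hp => ?_⟩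
    · refine ha.comp_columns (σ := fun α i => h (toLex (r α, i))) fun α i j hij => ?_
      have := he.injective hij
      simpa using this
    · have hb : ∀ q ∈ p.1.freeVarFinset, p.2.1 q.1 q.2.1 < n := fun q hq =>
        lt_of_lt_of_le (Nat.lt_succ_self _) <| (Finset.le_sup (f := fun q : ι × ℕ × W =>
          p.2.1 q.1 q.2.1 + 1) hq).trans <| Finset.le_sup (f := fun p : L.Formula (ι × ℕ × W) ×
            {σ : ι → ℕ → ℕ // ∀ α, StrictMono (σ α)} =>
            p.1.freeVarFinset.sup fun q => p.2.1 q.1 q.2.1 + 1) hp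
      let τ : ℕ → ℕ → ℕ := Function.extend r p.2.1 fun _ => id
      have hτr : ∀ α, τ (r α) = p.2.1 α := fun α => hr.extend_apply _ _ α
      have hτ : ∀ i, StrictMono (τ i) := fun i => by
        by_cases hi : ∃ α, r α = i
        · obtain ⟨α, rfl⟩ := hi
          rw [hτr]
          exact p.2.2 α
        · simp only [τ, Function.extend_apply' _ _ _ hi]
          exact strictMono_id
      have := hom p.1 (Finset.mem_image_of_mem _ hp) h
        (fun q => h (toLex ((ofLex q).1, τ (ofLex q).1 (ofLex q).2)))
        (hmono p.1 (fun _ => id) (fun _ => strictMono_id)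
          fun q hq => ((p.2.2 q.1).le_apply).trans_lt (hb q hq))
        (fun q _ => heH _) (hmono p.1 τ hτ fun q hq => by rw [hτr]; exact hb q hq)
        (fun q _ => heH _)
      rw [Formula.realize_iff, Formula.realize_relabel]
      simpa only [c, ofLex_toLex, hτr, Function.comp_def] using this
  obtain ⟨N, v, hv⟩ := T.exists_model_realize S M fun s hs => by
    have hs' : (↑(s.filter (· ∉ S₁)) : Set (L.Formula (ι × ℕ × W))) ⊆ Set.range
        fun p : L.Formula (ι × ℕ × W) × {σ : ι → ℕ → ℕ // ∀ α, StrictMono (σ α)} =>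
          p.1.iff (p.1.relabel fun q => (q.1, p.2.1 q.1 q.2.1, q.2.2)) := fun χ hχ => by
      rw [Finset.mem_coe, Finset.mem_filter] at hχ
      exact (hs hχ.1).resolve_left hχ.2
    rw [← Set.image_univ] at hs'
    obtain ⟨P, -, hP⟩ := Finset.subset_set_image_iff.1 hs'
    obtain ⟨v, hv₁, hv₂⟩ := hfin P
    refine ⟨v, fun χ hχ => ?_⟩
    by_cases hχ₁ : χ ∈ S₁
    · exact hχ₁ v hv₁
    · have : χ ∈ s.filter (· ∉ S₁) := Finset.mem_filter.2 ⟨hχ, hχ₁⟩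
      rw [← hP] at this
      obtain ⟨p, hp, rfl⟩ := Finset.mem_image.1 this
      exact hv₂ p hp
  refine ⟨N, fun α i w => v (α, i, w), isInpArray_iff_commonSolution.2
    ⟨fun α s hs => hv _ (Or.inl fun v hv => ?_), fun f s => hv _ (Or.inl fun v hv => ?_)⟩, ?_⟩
  · exact (isInpArray_iff_commonSolution.1 hv).1 α s hs
  · exact (isInpArray_iff_commonSolution.1 hv).2 f s
  · intro χ σ hσ
    have := hv _ (Or.inr ⟨(χ, ⟨σ, hσ⟩), rfl⟩)
    rw [Formula.realize_iff, Formula.realize_relabel] at this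
    exact this

end FirstOrder.Language

/-! ### Reducing the number of variables -/

namespace FirstOrder.Language

variable {L : Language.{u, v}}

/-- The predicate `P` on assignments in `N` is defined by a formula without parameters. There may be
infinitely many variables, of which the formula mentions finitely many. -/
def IsExpressible (L : Language.{u, v}) {N : Type w} [L.Structure N] {V : Type}
    (P : (V → N) → Prop) : Prop :=
  ∃ χ : L.Formula V, ∀ v, χ.Realize v ↔ P v

namespace IsExpressible

variable {N : Type w} [L.Structure N] {V X β : Type}

theorem comp_formula (χ : L.Formula X) (e : X → V) :
    IsExpressible L fun v : V → N => χ.Realize (v ∘ e) :=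
  ⟨χ.relabel e, fun _ => Formula.realize_relabel⟩

theorem and {P Q : (V → N) → Prop} (hP : IsExpressible L P) (hQ : IsExpressible L Q) :
    IsExpressible L fun v => P v ∧ Q v := by
  obtain ⟨χ, hχ⟩ := hP
  obtain ⟨ξ, hξ⟩ := hQ
  exact ⟨χ ⊓ ξ, fun v => by rw [Formula.realize_inf, hχ, hξ]⟩

theorem all [Finite β] {P : β → (V → N) → Prop} (h : ∀ b, IsExpressible L (P b)) :
    IsExpressible L fun v => ∀ b, P b v := by
  choose χ hχ using h
  exact ⟨Formula.iInf χ, fun v => by simp [hχ]⟩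

theorem all_finset {P : β → (V → N) → Prop} (s : Finset β)
    (h : ∀ b ∈ s, IsExpressible L (P b)) : IsExpressible L fun v => ∀ b ∈ s, P b v := by
  simpa using all (fun b : s => h b b.2)

theorem ex [Finite X] {P : (V → N) → (X → N) → Prop}
    (h : IsExpressible L fun v : V ⊕ X → N => P (v ∘ Sum.inl) (v ∘ Sum.inr)) :
    IsExpressible L fun v => ∃ x, P v x := by
  obtain ⟨χ, hχ⟩ := h
  exact ⟨Formula.iExs X χ, fun v => by simp [Formula.realize_iExs, hχ]⟩

theorem comp {P : (X → N) → Prop} (h : IsExpressible L P) (e : X → V) :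
    IsExpressible L fun v => P (v ∘ e) := by
  obtain ⟨χ, hχ⟩ := h
  exact ⟨χ.relabel e, fun v => by rw [Formula.realize_relabel, hχ]⟩

end IsExpressible

theorem IsMutuallyIndiscernible.iff_of_isExpressible {ι W : Type} {N : Type w} [L.Structure N]
    {a : ι → ℕ → W → N} (ha : IsMutuallyIndiscernible L a) {P : (ι × ℕ × W → N) → Prop}
    (hP : IsExpressible L P) {σ : ι → ℕ → ℕ} (hσ : ∀ α, StrictMono (σ α)) :
    P (fun p => a p.1 p.2.1 p.2.2) ↔ P fun p => a p.1 (σ p.1 p.2.1) p.2.2 := by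
  obtain ⟨χ, hχ⟩ := hP
  rw [← hχ, ← hχ]
  exact ha χ σ hσ

theorem exists_strictMono_mem_of_lt_card (s : Finset ℕ) :
    ∃ σ : ℕ → ℕ, StrictMono σ ∧ ∀ i < s.card, σ i ∈ s := by
  refine ⟨fun i => if h : i < s.card then s.orderEmbOfFin rfl ⟨i, h⟩ else s.sup id + 1 + i,
    fun i j hij => ?_, fun i hi => by simp [hi]⟩
  by_cases hj : j < s.card
  · have hi : i < s.card := hij.trans hj
    simpa [hi, hj] using hij
  · by_cases hi : i < s.card
    · have := Finset.le_sup (f := id) (s.orderEmbOfFin_mem rfl ⟨i, hi⟩)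
      simp only [id] at this
      simp only [hi, hj, dite_true, dite_false]
      exact this.trans_lt (by lia)
    · simpa [hi, hj] using hij

section Reduction

variable {J B Y Z W : Type} {N : Type w} [L.Structure N]

/-- The rows `(j, g j)`, `j ∈ s`, are free over a common `y`: every finite part of the following is
satisfied by some `y`: whichever path `f` through these rows is chosen, some `z` solves, together
with `y`, the formulas along `f` and those at column `0` of all rows in the blocks outside `s`. -/
def IsFreeChoice (φ : J × B → L.Formula ((Y ⊕ Z) ⊕ W)) (a : J × B → ℕ → W → N) (s : Finset J)
    (g : J → B) : Prop :=
  ∀ (n : ℕ) (F : Finset (J × B)), ∃ y : Y → N, ∀ f : J → ℕ, (∀ j ∈ s, f j < n) → ∃ z : Z → N,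
    (∀ j ∈ s, (φ (j, g j)).Realize (Sum.elim (Sum.elim y z) (a (j, g j) (f j)))) ∧
      ∀ α ∈ F, α.1 ∉ s → (φ α).Realize (Sum.elim (Sum.elim y z) (a α 0))

variable {φ : J × B → L.Formula ((Y ⊕ Z) ⊕ W)} {a : J × B → ℕ → W → N} {k : J × B → ℕ}

theorem IsFreeChoice.congr {s : Finset J} {g g' : J → B} (h : IsFreeChoice φ a s g)
    (hg : ∀ j ∈ s, g j = g' j) : IsFreeChoice φ a s g' := by
  intro n F
  obtain ⟨y, hy⟩ := h n F
  refine ⟨y, fun f hf => ?_⟩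
  obtain ⟨z, hz, hz'⟩ := hy f hf
  exact ⟨z, fun j hj => hg j hj ▸ hz j hj, hz'⟩

theorem IsInpArray.isFreeChoice_empty (h : IsInpArray φ k a) (g : J → B) :
    IsFreeChoice φ a ∅ g := by
  intro n F
  obtain ⟨x, hx⟩ := h.consistent 0 F
  refine ⟨x ∘ Sum.inl, fun f _ => ⟨x ∘ Sum.inr, by simp, fun α hα _ => ?_⟩⟩
  rw [Sum.elim_comp_inl_inr]
  exact hx α hα

/-- The condition on `y` that says that a finite part (`n` columns and the rows in `F`) of
`IsFreeChoice φ · s g` extends by the entry `((j, b), 0)`. Of the block `j` it involves this entry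
only, so the conditions for different `b` can be moved independently. -/
def freeChoiceTest (φ : J × B → L.Formula ((Y ⊕ Z) ⊕ W)) (s : Finset J) (g : J → B) (n : ℕ)
    (F : Finset (J × B)) (j : J) (b : B) (y : Y → N) (v : (J × B) × ℕ × W → N) : Prop :=
  ∀ f : s → Fin n, ∃ z : Z → N,
    ((∀ i : s, (φ (i, g i)).Realize
        (Sum.elim (Sum.elim y z) fun w => v ((i, g i), f i, w))) ∧
      ∀ α : F, α.1.1 ∉ s → α.1.1 ≠ j → (φ α).Realize
        (Sum.elim (Sum.elim y z) fun w => v (α, 0, w))) ∧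
    (φ (j, b)).Realize (Sum.elim (Sum.elim y z) fun w => v ((j, b), 0, w))

theorem isExpressible_freeChoiceTest [Finite Z] (φ : J × B → L.Formula ((Y ⊕ Z) ⊕ W))
    (s : Finset J) (g : J → B) (n : ℕ) (F : Finset (J × B)) (j : J) (b : B) :
    IsExpressible L fun u : Y ⊕ (J × B) × ℕ × W → N =>
      freeChoiceTest φ s g n F j b (u ∘ Sum.inl) (u ∘ Sum.inr) := by
  classical
  have hcell : ∀ (α : J × B) (i : ℕ), IsExpressible L fun t : (Y ⊕ (J × B) × ℕ × W) ⊕ Z → N =>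
      (φ α).Realize (Sum.elim (Sum.elim ((t ∘ Sum.inl) ∘ Sum.inl) (t ∘ Sum.inr))
        fun w => ((t ∘ Sum.inl) ∘ Sum.inr) (α, i, w)) := by
    intro α i
    convert IsExpressible.comp_formula (N := N) (φ α)
      (Sum.elim (Sum.elim (Sum.inl ∘ Sum.inl) Sum.inr)
        fun w => (Sum.inl (Sum.inr (α, i, w)) : (Y ⊕ (J × B) × ℕ × W) ⊕ Z)) using 3 with t
    ext ((q | q) | q) <;> rfl
  refine IsExpressible.all fun f => IsExpressible.ex (P := fun u z => _) ?_
  refine .and (.and (.all fun i => hcell _ _) (.all fun α => ?_)) (hcell _ _)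
  by_cases hα : α.1.1 ∉ s ∧ α.1.1 ≠ j
  · simpa [hα.1, hα.2] using hcell α.1 0
  · refine ⟨⊤, fun v => ?_⟩
    simp only [Formula.realize_top, true_iff]
    exact fun h₁ h₂ => absurd ⟨h₁, h₂⟩ hα

theorem freeChoiceTest_congr {s : Finset J} {g : J → B} {n : ℕ} {F : Finset (J × B)} {j : J}
    {b : B} {y : Y → N} {v v' : (J × B) × ℕ × W → N}
    (h : ∀ α : J × B, α.1 ≠ j → ∀ i w, v (α, i, w) = v' (α, i, w))
    (hj : ∀ w, v ((j, b), 0, w) = v' ((j, b), 0, w)) (hjs : j ∉ s)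
    (hv : freeChoiceTest φ s g n F j b y v) : freeChoiceTest φ s g n F j b y v' := by
  intro f
  obtain ⟨z, ⟨h₁, h₂⟩, h₃⟩ := hv f
  refine ⟨z, ⟨fun i => ?_, fun α hα hαj => ?_⟩, ?_⟩
  · have hi : (i : J) ≠ j := fun hi => hjs (hi ▸ i.2)
    simpa only [h (i, g i) hi] using h₁ i
  · simpa only [h α hαj] using h₂ α hα hαj
  · simpa only [hj] using h₃

/-- Either the free choice `g` on `s` extends to the block `j`, or the block yields an inp-array in the
variables `y` alone. In the second case, the failure for `b` bounds the number of entries of the row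
`(j, b)` for which `y` can pass `freeChoiceTest`, and the `y` witnessing that `g` is free on `s`
passes the tests of all the rows at column `0`. -/
theorem IsFreeChoice.exists_insert_or [DecidableEq J] [Finite Y] [Finite Z]
    (hmi : IsMutuallyIndiscernible L a)
    {s : Finset J} {g : J → B} (hg : IsFreeChoice φ a s g) {j : J} (hj : j ∉ s) :
    (∃ b, IsFreeChoice φ a (insert j s) (Function.update g j b)) ∨
    ∃ (ψ : B → L.Formula (Y ⊕ (J × B) × ℕ × W)) (m : B → ℕ)
      (c : B → ℕ → (J × B) × ℕ × W → N), IsInpArray ψ m c := by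
  classical
  rw [or_iff_not_imp_left]
  intro hno
  have hno' : ∀ b, ∃ (n : ℕ) (F : Finset (J × B)), ∀ y : Y → N, ∃ f : J → ℕ,
      (∀ i ∈ insert j s, f i < n) ∧ ∀ z : Z → N,
      (∀ i ∈ s, (φ (i, g i)).Realize (Sum.elim (Sum.elim y z) (a (i, g i) (f i)))) →
      (∀ α ∈ F, α.1 ∉ s → α.1 ≠ j → (φ α).Realize (Sum.elim (Sum.elim y z) (a α 0))) →
      ¬ (φ (j, b)).Realize (Sum.elim (Sum.elim y z) (a (j, b) (f j))) := by
    intro b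
    by_contra! hcon
    refine hno ⟨b, fun n F => ?_⟩
    obtain ⟨y, hy⟩ := hcon n F
    refine ⟨y, fun f hf => ?_⟩
    obtain ⟨z, h₁, h₂, h₃⟩ := hy f hf
    refine ⟨z, fun i hi => ?_, fun α hα hαs => ?_⟩
    · rcases Finset.mem_insert.1 hi with rfl | hi
      · simpa using h₃
      · have : i ≠ j := fun h => hj (h ▸ hi)
        simpa [Function.update_of_ne this] using h₁ i hi
    · rw [Finset.mem_insert, not_or] at hαs
      exact h₂ α hα hαs.2 hαs.1
  choose n F hnF using hno'
  -- the array with the row `(j, b)` shifted by `i`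
  let sh : B → ℕ → (J × B) × ℕ × W → N := fun b i p =>
    a p.1 (if p.1 = (j, b) then p.2.1 + i else p.2.1) p.2.2
  choose ψ hψ using fun b => isExpressible_freeChoiceTest (N := N) φ s g (n b) (F b) j b
  have hψ' : ∀ b y v, (ψ b).Realize (Sum.elim y v) ↔
      freeChoiceTest φ s g (n b) (F b) j b y v := fun b y v =>
    hψ b (Sum.elim y v)
  have hinc : ∀ b, ¬ ∃ y, ∀ i < n b, freeChoiceTest φ s g (n b) (F b) j b y (sh b i) := by
    rintro b ⟨y, hy⟩
    obtain ⟨f, hf, hfz⟩ := hnF b y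
    obtain ⟨z, ⟨h₁, h₂⟩, h₃⟩ := hy (f j) (hf j (Finset.mem_insert_self _ _))
      fun i => ⟨f i, hf i (Finset.mem_insert_of_mem i.2)⟩
    refine hfz z (fun i hi => ?_) (fun α hα hαs hαj => ?_) ?_
    · have hij : (i, g i) ≠ (j, b) := fun h => hj ((Prod.mk.inj h).1 ▸ hi)
      simpa only [sh, if_neg hij] using h₁ ⟨i, hi⟩
    · have hij : α ≠ (j, b) := fun h => hαj (congrArg Prod.fst h)
      simpa only [sh, if_neg hij] using h₂ ⟨α, hα⟩ hαs hαj
    · simpa only [sh, if_true, zero_add] using h₃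
  refine ⟨ψ, n, sh, ⟨?_, ?_⟩⟩
  -- columns in `t` are as good as the columns below `n b`, by indiscernibility of the row `(j, b)`
  · rintro b t ht ⟨y, hy⟩
    simp only [hψ'] at hy
    obtain ⟨τ, hτ, hτt⟩ := exists_strictMono_mem_of_lt_card t
    rw [ht] at hτt
    let σ : J × B → ℕ → ℕ := fun α => if α = (j, b) then τ else id
    have hσ : ∀ α, StrictMono (σ α) := fun α => by
      by_cases hα : α = (j, b)
      · simpa [σ, hα] using hτ
      · simpa [σ, hα] using strictMono_id
    have hex : IsExpressible L fun v : (J × B) × ℕ × W → N => ∃ y : Y → N, ∀ i : Fin (n b),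
        freeChoiceTest φ s g (n b) (F b) j b y
          fun p => v (p.1, if p.1 = (j, b) then p.2.1 + i else p.2.1, p.2.2) := by
      refine IsExpressible.ex (P := fun v y => _) (.all fun i => ?_)
      exact (isExpressible_freeChoiceTest φ s g (n b) (F b) j b).comp
        (Sum.elim Sum.inr fun p => Sum.inl (p.1, if p.1 = (j, b) then p.2.1 + i else p.2.1, p.2.2))
    refine hinc b (((hmi.iff_of_isExpressible hex hσ).2 ⟨y, fun i => ?_⟩).imp
      fun y hy i hi => hy ⟨i, hi⟩)
    refine freeChoiceTest_congr (fun α hα i w => ?_) (fun w => ?_) hj (hy _ (hτt i i.2))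
    · have : α ≠ (j, b) := fun h => hα (congrArg Prod.fst h)
      simp [sh, σ, this]
    · simp [sh, σ]
  -- column `0` can be moved to column `f b` in each row `(j, b)`
  · intro f t
    let σ : J × B → ℕ → ℕ := fun α => if α.1 = j then fun i => i + f α.2 else id
    have hσ : ∀ α, StrictMono (σ α) := fun α => by
      by_cases hα : α.1 = j
      · simpa [σ, hα] using add_left_strictMono
      · simpa [σ, hα] using strictMono_id
    have hex : IsExpressible L fun v : (J × B) × ℕ × W → N => ∃ y : Y → N, ∀ b ∈ t,
        freeChoiceTest φ s g (n b) (F b) j b y v := by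
      refine IsExpressible.ex (P := fun v y => _) (.all_finset t fun b _ => ?_)
      exact (isExpressible_freeChoiceTest φ s g (n b) (F b) j b).comp (Sum.elim Sum.inr Sum.inl)
    have h₀ : ∃ y : Y → N, ∀ b ∈ t,
        freeChoiceTest φ s g (n b) (F b) j b y fun p => a p.1 p.2.1 p.2.2 := by
      obtain ⟨y, hy⟩ := hg (t.sup n) (t.biUnion F ∪ t.map (Function.Embedding.sectR j B))
      refine ⟨y, fun b hb f => ?_⟩
      obtain ⟨z, h₁, h₂⟩ := hy (fun i => if hi : i ∈ s then f ⟨i, hi⟩ else 0) fun i hi => by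
        rw [dif_pos hi]
        exact (f ⟨i, hi⟩).2.trans_le (Finset.le_sup hb)
      refine ⟨z, ⟨fun i => ?_, fun α hα _ => ?_⟩, ?_⟩
      · simpa using h₁ i i.2
      · exact h₂ α (Finset.mem_union_left _ (Finset.mem_biUnion.2 ⟨b, hb, α.2⟩)) hα
      · exact h₂ (j, b) (Finset.mem_union_right _
          (Finset.mem_map_of_mem (Function.Embedding.sectR j B) hb)) hj
    obtain ⟨y, hy⟩ := (hmi.iff_of_isExpressible hex hσ).1 h₀
    refine ⟨y, fun b hb => (hψ' _ _ _).2 ?_⟩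
    refine freeChoiceTest_congr (fun α hα i w => ?_) (fun w => ?_) hj (hy b hb)
    · have : α ≠ (j, b) := fun h => hα (congrArg Prod.fst h)
      simp [sh, σ, this, hα]
    · simp [sh, σ]

/-- If the picked rows are free on arbitrarily large finite sets, they form an inp-array in the
variables `z`, the values of `y` having become parameters. The value of `y` depends on the finite set,
so that compactness is needed. -/
theorem IsInpArray.exists_isInpArray_of_isFreeChoice {T : L.Theory} [Nonempty N] [N ⊨ T]
    [Finite Z] (h : IsInpArray φ k a) {g : J → B}
    (hg : ∀ F : Finset J, ∃ s, F ⊆ s ∧ IsFreeChoice φ a s g) :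
    ∃ (N' : Theory.ModelType.{u, v, max u v} T) (ψ : J → L.Formula (Z ⊕ (Y ⊕ W)))
      (c : J → ℕ → Y ⊕ W → N'), IsInpArray ψ (fun j => k (j, g j)) c := by
  let e : (Y ⊕ Z) ⊕ W → Z ⊕ (Y ⊕ W) :=
    Sum.elim (Sum.elim (Sum.inr ∘ Sum.inl) Sum.inl) (Sum.inr ∘ Sum.inr)
  have he : ∀ (y : Y → N) (z : Z → N) (p : W → N),
      Sum.elim z (Sum.elim y p) ∘ e = Sum.elim (Sum.elim y z) p := fun y z p => by
    ext ((q | q) | q) <;> rfl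
  obtain ⟨N', c, hc⟩ := Theory.exists_isInpArray_of_finite (T := T) (M := N)
    (fun j => (φ (j, g j)).relabel e) (fun j => k (j, g j)) fun F n => by
      obtain ⟨s, hFs, hs⟩ := hg F
      obtain ⟨y, hy⟩ := hs n ∅
      refine ⟨fun j i => Sum.elim y (a (j, g j) i), fun j _ t _ ht => ?_, fun f hf => ?_⟩
      · rintro ⟨z, hz⟩
        refine h.inconsistent (j, g j) t ht ⟨Sum.elim y z, fun i hi => ?_⟩
        have := hz i hi
        rwa [Formula.realize_relabel, he] at this
      · obtain ⟨z, hz, -⟩ := hy f fun j _ => hf j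
        refine ⟨z, fun j hj => ?_⟩
        rw [Formula.realize_relabel, he]
        exact hz j (hFs hj)
  exact ⟨N', _, c, hc⟩

end Reduction

end FirstOrder.Language

/-! ### Submultiplicativity of burden -/

namespace FirstOrder.Language.Theory

variable {L : Language.{u, v}} {T : L.Theory}

/-- Some model of `T` has an inp-array in `n` variables with rows indexed by `ι`. -/
def HasInpArray (T : L.Theory) (n : ℕ) (ι : Type) : Prop :=
  ∃ (N : Theory.ModelType.{u, v, max u v} T) (W : Type) (φ : ι → L.Formula (Fin n ⊕ W))
    (k : ι → ℕ) (a : ι → ℕ → W → N), IsInpArray φ k a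

theorem HasInpArray.of_injective {n : ℕ} {ι ι' : Type} (h : T.HasInpArray n ι) {e : ι' → ι}
    (he : Function.Injective e) : T.HasInpArray n ι' := by
  obtain ⟨N, W, φ, k, a, ha⟩ := h
  exact ⟨N, W, _, _, _, ha.comp_rows he⟩

theorem HasInpArray.isEmpty_of_zero {ι : Type} (h : T.HasInpArray 0 ι) : IsEmpty ι := by
  obtain ⟨N, W, φ, k, a, ha⟩ := h
  refine ⟨fun α => ha.inconsistent α (Finset.range (k α)) (by simp) ⟨default, fun i _ => ?_⟩⟩
  obtain ⟨x, hx⟩ := ha.consistent (fun _ => i) {α}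
  rw [Subsingleton.elim default x]
  exact hx α (by simp)

/-- A formula mentions finitely many of its parameter variables only. -/
theorem exists_formula_fin {X : Type} {W : Type w'} (φ : L.Formula (X ⊕ W)) :
    ∃ (m : ℕ) (χ : L.Formula (X ⊕ Fin m)) (e : Fin m → W), ∀ (N : Type w) [L.Structure N]
      (x : X → N) (p : W → N), χ.Realize (Sum.elim x (p ∘ e)) ↔ φ.Realize (Sum.elim x p) := by
  classical
  let s : Finset W := φ.freeVarFinset.toRight
  let f : φ.freeVarFinset → X ⊕ Fin s.card := fun q =>
    match q with
    | ⟨Sum.inl x, _⟩ => Sum.inl x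
    | ⟨Sum.inr w, hw⟩ => Sum.inr (s.equivFin ⟨w, Finset.mem_toRight.2 hw⟩)
  refine ⟨s.card, BoundedFormula.restrictFreeVar φ f, fun i => s.equivFin.symm i, ?_⟩
  intro N _ x p
  refine BoundedFormula.realize_restrictFreeVar _ ?_
  rintro ⟨q | q, hq⟩ <;> simp [f]

theorem HasInpArray.hasInpPattern {n : ℕ} {ι : Type} (h : T.HasInpArray n ι) :
    T.HasInpPattern n (Cardinal.lift.{max u v} #ι) := by
  obtain ⟨N, W, φ, k, a, ha⟩ := h
  choose m χ e hχ using fun α => exists_formula_fin.{u, v, max u v, 0} (φ α)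
  refine ⟨N, ULift ι, by simp, ⟨⟨fun α => m α.down, fun α => χ α.down,
    fun α i => a α.down i ∘ e α.down, fun α => k α.down, fun α s hs => ?_, fun f s => ?_⟩⟩⟩
  · simpa only [hχ] using ha.inconsistent α.down s hs
  · obtain ⟨x, hx⟩ := ha.consistent (fun α => f ⟨α⟩) (s.map Equiv.ulift.toEmbedding)
    exact ⟨x, fun α hα => (hχ _ _ _ _).2 (hx α.down (Finset.mem_map_of_mem _ hα))⟩

theorem exists_isFreeChoice_of_finset {J B Y Z W : Type} [DecidableEq J] [Nonempty B]
    {N : Type w} [L.Structure N] {φ : J × B → L.Formula ((Y ⊕ Z) ⊕ W)} {a : J × B → ℕ → W → N}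
    {k : J × B → ℕ} (ha : IsInpArray φ k a)
    (hstep : ∀ (s : Finset J) (g : J → B), IsFreeChoice φ a s g → ∀ j ∉ s,
      ∃ b, IsFreeChoice φ a (insert j s) (Function.update g j b)) (s : Finset J) :
    ∃ g, IsFreeChoice φ a s g := by
  induction s using Finset.induction_on with
  | empty => exact ⟨fun _ => Classical.arbitrary B, ha.isFreeChoice_empty _⟩
  | insert j s hj ih =>
    obtain ⟨g, hg⟩ := ih
    obtain ⟨b, hb⟩ := hstep s g hg j hj
    exact ⟨_, hb⟩

theorem exists_isFreeChoice_range {B Y Z W : Type} [Nonempty B]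
    {N : Type w} [L.Structure N] {φ : ℕ × B → L.Formula ((Y ⊕ Z) ⊕ W)} {a : ℕ × B → ℕ → W → N}
    {k : ℕ × B → ℕ} (ha : IsInpArray φ k a)
    (hstep : ∀ (s : Finset ℕ) (g : ℕ → B), IsFreeChoice φ a s g → ∀ j ∉ s,
      ∃ b, IsFreeChoice φ a (insert j s) (Function.update g j b)) :
    ∃ g, ∀ m, IsFreeChoice φ a (Finset.range m) g := by
  choose! b hb using fun (g : ℕ → B) (m : ℕ) (hg : IsFreeChoice φ a (Finset.range m) g) =>
    hstep _ g hg m (by simp)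
  let G : ℕ → ℕ → B := fun m => Nat.rec (fun _ => Classical.arbitrary B)
    (fun m g => Function.update g m (b g m)) m
  have hG : ∀ m, IsFreeChoice φ a (Finset.range m) (G m) := fun m => by
    induction m with
    | zero => exact ha.isFreeChoice_empty _
    | succ m ih =>
      rw [Finset.range_add_one]
      exact hb _ m ih
  refine ⟨fun j => G (j + 1) j, fun m => (hG m).congr fun j hj => ?_⟩
  induction m with
  | zero => simp at hj
  | succ m ih =>
    rcases (Finset.mem_range_succ_iff.1 hj).lt_or_eq with hlt | rfl
    · rw [← ih (Finset.mem_range.2 hlt)]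
      exact Function.update_of_ne hlt.ne _ _
    · rfl

/-- Submultiplicativity of burden: a pattern with rows `J × B` in `n + 1` variables gives one with rows
`B` in one variable or one with rows `J` in `n` variables. The rows of the latter are picked block by
block, in order of type at most `ω`. -/
theorem HasInpArray.of_succ {J B : Type} [Nonempty B] [Countable B] {n : ℕ}
    (h : T.HasInpArray (n + 1) (J × B)) (hB : ¬ T.HasInpArray 1 B) (hJ : J = ℕ ∨ Finite J) :
    T.HasInpArray n J := by
  classical
  have hJc : Countable J := by
    rcases hJ with rfl | hJ <;> infer_instance
  obtain ⟨N₀, W, φ₀, k, a₀, ha₀⟩ := h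
  obtain ⟨φ, ha₁⟩ : ∃ φ : J × B → L.Formula ((Fin 1 ⊕ Fin n) ⊕ W), IsInpArray φ k a₀ :=
    ⟨_, ha₀.relabel_vars ((finCongr (add_comm n 1)).trans finSumFinEquiv.symm)⟩
  obtain ⟨N, a, ha, hmi⟩ := exists_mutuallyIndiscernible_isInpArray (T := T) ha₁
  have hstep : ∀ (s : Finset J) (g : J → B), IsFreeChoice φ a s g → ∀ j ∉ s,
      ∃ b, IsFreeChoice φ a (insert j s) (Function.update g j b) := fun s g hg j hj =>
    (hg.exists_insert_or hmi hj).resolve_right fun ⟨ψ, m, c, hc⟩ => hB ⟨N, _, ψ, m, c, hc⟩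
  obtain ⟨g, hg⟩ : ∃ g : J → B, ∀ F : Finset J, ∃ s, F ⊆ s ∧ IsFreeChoice φ a s g := by
    rcases hJ with rfl | hJ
    · obtain ⟨g, hg⟩ := exists_isFreeChoice_range ha (by convert hstep)
      exact ⟨g, fun F => ⟨_, F.subset_range_sup_succ, hg _⟩⟩
    · have := Fintype.ofFinite J
      obtain ⟨g, hg⟩ := exists_isFreeChoice_of_finset ha hstep Finset.univ
      exact ⟨g, fun F => ⟨_, F.subset_univ, hg⟩⟩
  obtain ⟨N', ψ, c, hc⟩ := ha.exists_isInpArray_of_isFreeChoice (T := T) hg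
  exact ⟨N', _, ψ, _, c, hc⟩

theorem IsStrong.not_hasInpArray (hT : T.IsStrong) (n : ℕ) : ¬ T.HasInpArray n ℕ := by
  have h₁ : ¬ T.HasInpArray 1 ℕ := fun h => by
    simpa using hT _ h.hasInpPattern
  induction n with
  | zero => exact fun h => h.isEmpty_of_zero.false 0
  | succ n ih =>
    exact fun h => ih ((h.of_injective (e := Nat.pairEquiv) Nat.pairEquiv.injective).of_succ h₁
      (Or.inl rfl))

theorem BurdenLE.not_hasInpArray {b : ℕ} (hT : T.BurdenLE b) (n : ℕ) :
    ¬ T.HasInpArray n (Fin ((b + 1) ^ n)) := by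
  have h₁ : ¬ T.HasInpArray 1 (Fin (b + 1)) := fun h => by
    have := hT _ h.hasInpPattern
    simp only [mk_fin, lift_natCast] at this
    exact absurd (Nat.cast_le.1 this) (by omega)
  induction n with
  | zero => exact fun h => h.isEmpty_of_zero.false ⟨0, by simp⟩
  | succ n ih =>
    exact fun h => ih ((h.of_injective (e := finProdFinEquiv) finProdFinEquiv.injective).of_succ h₁
      (Or.inr inferInstance))

end FirstOrder.Language.Theory

/-! ### Patterns from type-definable subgroups -/

namespace FirstOrder.Language

variable {L : Language.{u, v}} {M : Type w} [L.Structure M] {κ : Cardinal.{w}}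

theorem exists_formulas_of_subset {α : Type} {A B : Set M} (h : A ⊆ B)
    (p : Set (L[[A]].Formula α)) : ∃ q : Set (L[[B]].Formula α), ∀ x : α → M,
      (∀ φ ∈ q, φ.Realize x) ↔ ∀ φ ∈ p, φ.Realize x := by
  refine ⟨(L.lhomWithConstantsMap (Set.inclusion h)).onFormula '' p, fun x => ?_⟩
  rw [Set.forall_mem_image]
  exact forall₂_congr fun φ _ => LHom.realize_onFormula _ φ

theorem IsSaturated.exists_realize (hM : IsSaturated L M κ) {A : Set M} (hA : #A < κ)
    {V : Type} [Finite V] {I : Type*} (F : I → L[[A]].Formula V)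
    (h : ∀ s : Finset I, ∃ x : V → M, ∀ i ∈ s, (F i).Realize x) :
    ∃ x : V → M, ∀ i, (F i).Realize x := by
  classical
  obtain ⟨m, ⟨e⟩⟩ := Finite.exists_equiv_fin V
  obtain ⟨x, hx⟩ := hM A hA m (Set.range fun i => (F i).relabel e) fun s hs => by
    rw [← Set.image_univ] at hs
    obtain ⟨t, -, rfl⟩ := Finset.subset_set_image_iff.1 hs
    obtain ⟨x, hx⟩ := h t
    refine ⟨x ∘ e.symm, Finset.forall_mem_image.2 fun i hi => ?_⟩
    rw [Formula.realize_relabel]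
    simpa [Function.comp_assoc] using hx i hi
  exact ⟨x ∘ e, fun i => Formula.realize_relabel.1 (hx _ ⟨i, rfl⟩)⟩

theorem IsMonster.mk_formula_lt (hM : IsMonster L M κ) {A : Set M} (hA : #A < κ) (n : ℕ) :
    #(L[[A]].Formula (Fin n)) < Cardinal.lift.{max u v} κ := by
  have h₁ : #(L[[A]].Formula (Fin n)) ≤ #(Σ m, L[[A]].BoundedFormula (Fin n) m) :=
    mk_le_of_injective (f := fun φ => ⟨0, φ⟩) fun φ ψ h => by simpa using h
  have hω : ℵ₀ < Cardinal.lift.{max u v} κ := by simpa using hM.aleph0_lt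
  refine h₁.trans_lt (BoundedFormula.card_le.trans_lt (max_lt hω ?_))
  refine add_lt_of_lt hω.le ?_ ?_
  · simpa using (natCast_lt_aleph0 (n := n)).trans hω
  · rw [card_withConstants]
    rw [lift_add, lift_lift, lift_lift]
    refine add_lt_of_lt hω.le ?_ ?_
    · simpa using hM.card_lt
    · exact lift_lt.2 hA

/-- A set that is separated by functions from a set of formulas over a small set to `ℕ` is small. -/
theorem IsMonster.mk_lt_of_injective (hM : IsMonster L M κ) {A : Set M} (hA : #A < κ) {n : ℕ}
    (p : Set (L[[A]].Formula (Fin n))) {Q : Type w} {f : Q → p → ℕ}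
    (hf : Function.Injective f) : #Q < κ := by
  obtain ⟨c, hc, hcp⟩ := lt_lift_iff.1 ((mk_set_le p).trans_lt (hM.mk_formula_lt hA n))
  have hQ : Cardinal.lift.{max u v} #Q ≤ #(p → ℕ) := by
    have := lift_mk_le_lift_mk_of_injective hf
    rwa [lift_umax.{w, max u v}, lift_id'.{w, max u v}] at this
  have h₂ : #(p → ℕ) ≤ Cardinal.lift.{max u v} (2 ^ max ℵ₀ c) := by
    rw [← power_self_eq (le_max_left ℵ₀ c), lift_power, lift_max, lift_aleph0, hcp, mk_arrow, mk_nat,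
      lift_aleph0, lift_uzero]
    exact (power_le_power_right (le_max_left _ _)).trans
      (power_le_power_left (aleph0_pos.trans_le (le_max_left _ _)).ne' (le_max_right _ _))
  exact (lift_le.1 (hQ.trans h₂)).trans_lt
    (hM.isStrongLimit.isStrongPrelimit (max_lt hM.aleph0_lt hc))

section Row

variable {n : ℕ} {G : Set (Fin n → M)} [Group G]

/-- The formula `∃ w, ⋀ s (x, g, w)` in the variables `(x, g)`. It is used for finite parts `s` of a
type that says `x = g * w` and `w ∈ H`, so that it approximates `x ∈ g * H`. -/
noncomputable def cosetFormula {A : Set M} {n : ℕ}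
    (s : Finset (L[[A]].Formula ((Fin n ⊕ Fin n) ⊕ Fin n))) : L[[A]].Formula (Fin n ⊕ Fin n) :=
  Formula.iExs (Fin n) (Formula.iInf fun φ : s => φ.1)

theorem realize_cosetFormula {A : Set M} (s : Finset (L[[A]].Formula ((Fin n ⊕ Fin n) ⊕ Fin n)))
    (y : Fin n ⊕ Fin n → M) : (cosetFormula s).Realize y ↔
      ∃ w : Fin n → M, ∀ φ ∈ s, φ.Realize (Sum.elim y w) := by
  simp [cosetFormula, Formula.realize_iExs, Formula.realize_iInf]

/-- A formula `θ (x, g)` that approximates `x ∈ g * H` so closely that two elements `g`, `g'` of the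
group whose approximate cosets both meet that of the same `e` satisfy `φ (g⁻¹ * g')`, for a given
formula `φ` that holds on `H`. It exists by saturation, as the conclusion holds for the cosets
themselves. -/
theorem exists_cosetFormula (hM : IsSaturated L M κ) {A : Set M} (hA : #A < κ)
    (H : Subgroup G) {pG : Set (L[[A]].Formula (Fin n ⊕ Fin n ⊕ Fin n))}
    (hG : ∀ x, (∀ φ ∈ pG, φ.Realize x) ↔ ∃ a b : G, x = Sum.elim (a : Fin n → M)
      (Sum.elim (b : Fin n → M) ((a * b : G) : Fin n → M)))
    {pH : Set (L[[A]].Formula (Fin n))}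
    (hH : ∀ x, (∀ φ ∈ pH, φ.Realize x) ↔ ∃ h ∈ H, (h : Fin n → M) = x)
    {φ : L[[A]].Formula (Fin n)} (hφ : φ ∈ pH) :
    ∃ θ : L[[A]].Formula (Fin n ⊕ Fin n),
      (∀ g : G, ∀ h ∈ H, θ.Realize (Sum.elim ((g * h : G) : Fin n → M) (g : Fin n → M))) ∧
      ∀ (e x x' : Fin n → M) (g g' : G), θ.Realize (Sum.elim x e) → θ.Realize (Sum.elim x g) →
        θ.Realize (Sum.elim x' e) → θ.Realize (Sum.elim x' g') →
        φ.Realize ((g⁻¹ * g' : G) : Fin n → M) := by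
  classical
  let pQ : Set (L[[A]].Formula ((Fin n ⊕ Fin n) ⊕ Fin n)) :=
    (fun χ => χ.relabel (Sum.elim (Sum.inl ∘ Sum.inr) (Sum.elim Sum.inr (Sum.inl ∘ Sum.inl)))) '' pG
      ∪ (fun χ => χ.relabel Sum.inr) '' pH
  have hQ : ∀ x g w : Fin n → M, (∀ χ ∈ pQ, χ.Realize (Sum.elim (Sum.elim x g) w)) ↔
      ∃ a : G, ∃ h ∈ H, (a : Fin n → M) = g ∧ (h : Fin n → M) = w ∧
        ((a * h : G) : Fin n → M) = x := by
    intro x g w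
    have h₁ : Sum.elim (Sum.elim x g) w ∘
        Sum.elim (Sum.inl ∘ Sum.inr) (Sum.elim Sum.inr (Sum.inl ∘ Sum.inl)) =
        Sum.elim g (Sum.elim w x) := by ext (q | q | q) <;> rfl
    have hp : (∀ χ ∈ pQ, χ.Realize (Sum.elim (Sum.elim x g) w)) ↔
        (∀ χ ∈ pG, χ.Realize (Sum.elim g (Sum.elim w x))) ∧ ∀ χ ∈ pH, χ.Realize w := by
      simp only [pQ, Set.mem_union, or_imp, forall_and, Set.forall_mem_image,
        Formula.realize_relabel, h₁, Sum.elim_comp_inr]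
    rw [hp, hG, hH]
    constructor
    · rintro ⟨⟨a, b, hab⟩, h, hh, rfl⟩
      have ha : g = a := by simpa using congrArg (· ∘ Sum.inl) hab
      have hb : (h : Fin n → M) = b := by
        simpa [Function.comp_def] using congrArg (· ∘ Sum.inr ∘ Sum.inl) hab
      have hx : x = (a * b : G) := by
        simpa [Function.comp_def] using congrArg (· ∘ Sum.inr ∘ Sum.inr) hab
      obtain rfl : h = b := Subtype.ext hb
      exact ⟨a, h, hh, ha.symm, rfl, hx.symm⟩
    · rintro ⟨a, h, hh, rfl, rfl, rfl⟩
      exact ⟨⟨a, h, rfl⟩, h, hh, rfl⟩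
  by_contra! hcon
  -- slots: `e, g, g', x, x'`, the four witnesses, and `g⁻¹ * g'`
  let X : Fin 4 → Fin 10 := ![3, 3, 4, 4]
  let E : Fin 4 → Fin 10 := ![0, 1, 0, 2]
  let V : Fin 4 → Fin 10 := ![5, 6, 7, 8]
  let F : (Fin 4 × pQ) ⊕ pG ⊕ Unit → L[[A]].Formula (Fin 10 × Fin n) := Sum.elim
    (fun q => q.2.1.relabel (Sum.elim (Sum.elim (Prod.mk (X q.1)) (Prod.mk (E q.1)))
      (Prod.mk (V q.1)))) <| Sum.elim
    (fun χ => χ.1.relabel (Sum.elim (Prod.mk 1) (Sum.elim (Prod.mk 9) (Prod.mk 2))))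
    fun _ => (φ.relabel (Prod.mk 9)).not
  have hF₁ : ∀ (t : Fin 10 × Fin n → M) (i : Fin 4) (χ : pQ), (F (Sum.inl (i, χ))).Realize t ↔
      χ.1.Realize (Sum.elim (Sum.elim (fun l => t (X i, l)) fun l => t (E i, l))
        fun l => t (V i, l)) := fun t i χ => by
    simp only [F, Sum.elim_inl, Formula.realize_relabel, Sum.comp_elim]
    rfl
  have hF₂ : ∀ (t : Fin 10 × Fin n → M) (χ : pG), (F (Sum.inr (Sum.inl χ))).Realize t ↔
      χ.1.Realize (Sum.elim (fun l => t (1, l)) (Sum.elim (fun l => t (9, l))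
        fun l => t (2, l))) := fun t χ => by
    simp only [F, Sum.elim_inl, Sum.elim_inr, Formula.realize_relabel, Sum.comp_elim]
    rfl
  have hF₃ : ∀ (t : Fin 10 × Fin n → M), (F (Sum.inr (Sum.inr ()))).Realize t ↔
      ¬ φ.Realize fun l => t (9, l) := fun t => by
    simp only [F, Sum.elim_inr, Formula.realize_relabel, Formula.realize_not]
    rfl
  obtain ⟨t, ht⟩ := hM.exists_realize hA F fun s => by
    obtain ⟨e, x, x', g, g', h₁, h₂, h₃, h₄, h₅⟩ := hcon
      (cosetFormula (s.toLeft.image fun q => q.2.1)) fun g h hh => by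
        rw [realize_cosetFormula]
        refine ⟨h, Finset.forall_mem_image.2 fun q _ => ?_⟩
        exact (hQ _ _ _).2 ⟨g, h, hh, rfl, rfl, rfl⟩ _ q.2.2
    rw [realize_cosetFormula] at h₁ h₂ h₃ h₄
    obtain ⟨w₁, h₁⟩ := h₁
    obtain ⟨w₂, h₂⟩ := h₂
    obtain ⟨w₃, h₃⟩ := h₃
    obtain ⟨w₄, h₄⟩ := h₄
    refine ⟨fun q => (![e, g, g', x, x', w₁, w₂, w₃, w₄, ((g⁻¹ * g' : G) : Fin n → M)] :
      Fin 10 → Fin n → M) q.1 q.2, ?_⟩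
    rintro (⟨i, χ⟩ | χ | ⟨⟩) hs
    · rw [hF₁]
      have hχ : χ.1 ∈ s.toLeft.image fun q => q.2.1 :=
        Finset.mem_image.2 ⟨(i, χ), Finset.mem_toLeft.2 hs, rfl⟩
      fin_cases i
      · exact h₁ _ hχ
      · exact h₂ _ hχ
      · exact h₃ _ hχ
      · exact h₄ _ hχ
    · rw [hF₂]
      exact (hG _).2 ⟨g, g⁻¹ * g', by rw [mul_inv_cancel_left]; rfl⟩ _ χ.2
    · rw [hF₃]
      exact h₅
  have hrel := fun i : Fin 4 => (hQ _ _ _).1 fun χ hχ => (hF₁ t i ⟨χ, hχ⟩).1 (ht _)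
  obtain ⟨a₀, m₀, hm₀, ha₀, -, hx₀⟩ := hrel 0
  obtain ⟨a₁, m₁, hm₁, ha₁, -, hx₁⟩ := hrel 1
  obtain ⟨a₂, m₂, hm₂, ha₂, -, hx₂⟩ := hrel 2
  obtain ⟨a₃, m₃, hm₃, ha₃, -, hx₃⟩ := hrel 3
  obtain ⟨b, c, hbc⟩ := (hG _).1 fun χ hχ => (hF₂ t ⟨χ, hχ⟩).1 (ht _)
  have hb : (fun l => t (1, l)) = (b : Fin n → M) := by simpa using congrArg (· ∘ Sum.inl) hbc
  have hc : (fun l => t (9, l)) = (c : Fin n → M) := by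
    simpa [Function.comp_def] using congrArg (· ∘ Sum.inr ∘ Sum.inl) hbc
  have hd : (fun l => t (2, l)) = ((b * c : G) : Fin n → M) := by
    simpa [Function.comp_def] using congrArg (· ∘ Sum.inr ∘ Sum.inr) hbc
  have e₁ : a₁ = b := Subtype.ext (ha₁.trans hb)
  have e₂ : a₃ = b * c := Subtype.ext (ha₃.trans hd)
  have e₃ : a₀ = a₂ := Subtype.ext (ha₀.trans ha₂.symm)
  have e₄ : a₀ * m₀ = a₁ * m₁ := Subtype.ext (hx₀.trans hx₁.symm)
  have e₅ : a₂ * m₂ = a₃ * m₃ := Subtype.ext (hx₂.trans hx₃.symm)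
  refine (hF₃ t).1 (ht _) ?_
  refine (hH _).2 ⟨c, ?_, hc.symm⟩ φ hφ
  have : c = m₁ * m₀⁻¹ * m₂ * m₃⁻¹ := by
    have h₁ : b = a₂ * m₀ * m₁⁻¹ := by rw [← e₁, ← e₃, e₄, mul_inv_cancel_right]
    have h₂ : b * c = a₂ * m₂ * m₃⁻¹ := by rw [← e₂, e₅, mul_inv_cancel_right]
    rw [← inv_mul_cancel_left b c, h₂, h₁]
    group
  rw [this]
  exact H.mul_mem (H.mul_mem (H.mul_mem hm₁ (H.inv_mem hm₀)) hm₂) (H.inv_mem hm₃)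

/-- Turning the parameters of a formula, constants from `A` and the variables `g`, into a sequence. -/
theorem exists_formula_nat [Nonempty M] {X : Type} {A : Set M} (θ : L[[A]].Formula (X ⊕ X)) :
    ∃ (χ : L.Formula (X ⊕ ℕ)) (d : (X → M) → ℕ → M), ∀ x g : X → M,
      χ.Realize (Sum.elim x (d g)) ↔ θ.Realize (Sum.elim x g) := by
  obtain ⟨m, χ, e, hχ⟩ := Theory.exists_formula_fin
    (Formula.relabel (Sum.elim (Sum.inr ∘ Sum.inl) (Sum.map id Sum.inr) :
      A ⊕ (X ⊕ X) → X ⊕ (A ⊕ X)) (BoundedFormula.constantsVarsEquiv θ : L.Formula (A ⊕ (X ⊕ X))))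
  refine ⟨χ.relabel (Sum.map id Fin.val), fun g l =>
    if hl : l < m then Sum.elim (fun c : A => (c : M)) g (e ⟨l, hl⟩) else Classical.arbitrary M,
    fun x g => ?_⟩
  have h₁ := hχ M x (Sum.elim (fun c : A => (c : M)) g)
  rw [Formula.realize_relabel] at h₁ ⊢
  refine (Iff.trans ?_ h₁).trans ?_
  · rw [Sum.elim_comp_map]
    have : (fun l : ℕ => if hl : l < m then Sum.elim (fun c : A => (c : M)) g (e ⟨l, hl⟩) else
        Classical.arbitrary M) ∘ Fin.val = Sum.elim (fun c : A => (c : M)) g ∘ e := by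
      ext l
      simp
    rw [this, Function.comp_id]
  · have : Sum.elim x (Sum.elim (fun c : A => (c : M)) g) ∘
        Sum.elim (Sum.inr ∘ Sum.inl) (Sum.map id Sum.inr) =
        Sum.elim (fun c : A => ((L.con c : L[[A]].Constants) : M)) (Sum.elim x g) := by
      ext (q | q | q) <;> simp
    rw [this]
    exact BoundedFormula.realize_constantsVarsEquiv

/-- If the index of `H` in `K` is unbounded, there are infinitely many elements of `K` whose cosets of
`H` are contained in pairwise disjoint instances of one formula. -/
theorem exists_row [Nonempty M] (hM : IsMonster L M κ) (hG : IsTypeDefinableGroup L κ G)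
    {H : Subgroup G} (hH : IsTypeDefinableSubgroup L κ H) {K : Subgroup G}
    (hK : ¬ BoundedIndex κ K H) :
    ∃ (χ : L.Formula (Fin n ⊕ ℕ)) (g : ℕ → G) (a : ℕ → ℕ → M), (∀ i, g i ∈ K) ∧
      (∀ i, ∀ h ∈ H, χ.Realize (Sum.elim ((g i * h : G) : Fin n → M) (a i))) ∧
      ∀ i j, i < j → ¬ ∃ x : Fin n → M, χ.Realize (Sum.elim x (a i)) ∧
        χ.Realize (Sum.elim x (a j)) := by
  obtain ⟨A₁, hA₁, p₁, hp₁⟩ := hG.graph_mul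
  obtain ⟨A₂, hA₂, p₂, hp₂⟩ := hH
  have hA : #(A₁ ∪ A₂ : Set M) < κ :=
    (mk_union_le _ _).trans_lt (add_lt_of_lt hM.aleph0_lt.le hA₁ hA₂)
  obtain ⟨pG, hpG⟩ := exists_formulas_of_subset (Set.subset_union_left (s := A₁) (t := A₂)) p₁
  obtain ⟨pH, hpH⟩ := exists_formulas_of_subset (Set.subset_union_right (s := A₁) (t := A₂)) p₂
  have hpG' : ∀ x, (∀ φ ∈ pG, φ.Realize x) ↔ ∃ a b : G, x = Sum.elim (a : Fin n → M)
      (Sum.elim (b : Fin n → M) ((a * b : G) : Fin n → M)) := fun x =>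
    (hpG x).trans (Set.ext_iff.1 hp₁ x).symm
  have hpH' : ∀ x, (∀ φ ∈ pH, φ.Realize x) ↔ ∃ h ∈ H, (h : Fin n → M) = x := fun x =>
    (hpH x).trans (Set.ext_iff.1 hp₂ x).symm
  choose θ hθ hθφ using fun φ : pH => exists_cosetFormula hM.isSaturated hA H hpG' hpH' φ.2
  by_cases hfin : ∀ φ : pH, ∃ E : Finset K, ∀ g : K, ∃ e ∈ E, ∃ x : Fin n → M,
      (θ φ).Realize (Sum.elim x (e : G)) ∧ (θ φ).Realize (Sum.elim x (g : G))
  -- finitely many `e` for each `φ`: a coset is determined by the `e` that its elements meet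
  · refine absurd ?_ hK
    choose E f hfE x hxe hxg using hfin
    refine hM.mk_lt_of_injective hA pH (Q := K ⧸ H.subgroupOf K)
      (f := fun q φ => (E φ).equivFin ⟨f φ q.out, hfE φ q.out⟩) fun q q' hqq => ?_
    have hff : ∀ φ, f φ q.out = f φ q'.out := fun φ => by
      have := congrFun hqq φ
      simpa [Fin.val_inj] using this
    rw [← q.out_eq, ← q'.out_eq]
    refine QuotientGroup.eq.2 (Subgroup.mem_subgroupOf.2 ?_)
    obtain ⟨h, hh, hhx⟩ := (hpH' ((((q.out : K) : G)⁻¹ * ((q'.out : K) : G) : G) : Fin n → M)).1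
      fun φ hφ => hθφ ⟨φ, hφ⟩ _ _ _ _ _ (hxe _ _) (hxg _ _)
        (by rw [hff ⟨φ, hφ⟩]; exact hxe _ _) (hxg _ _)
    have hh' : h = ((q.out : K) : G)⁻¹ * ((q'.out : K) : G) := Subtype.ext hhx
    change ((q.out : K) : G)⁻¹ * ((q'.out : K) : G) ∈ H
    exact hh' ▸ hh
  · push Not at hfin
    obtain ⟨φ, hφ⟩ := hfin
    obtain ⟨g, -, hg⟩ := exists_seq_of_forall_finset_exists (fun _ : K => True)
      (fun e g => ∀ x : Fin n → M, (θ φ).Realize (Sum.elim x (e : G)) →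
        ¬ (θ φ).Realize (Sum.elim x (g : G))) fun s _ => by
          obtain ⟨y, hy⟩ := hφ s
          exact ⟨y, trivial, hy⟩
    obtain ⟨χ, d, hχ⟩ := exists_formula_nat (θ φ)
    refine ⟨χ, fun i => g i, fun i => d (g i : G), fun i => (g i).2, fun i h hh => ?_, ?_⟩
    · exact (hχ _ _).2 (hθ φ (g i) h hh)
    · rintro i j hij ⟨x, h₁, h₂⟩
      exact hg i j hij x ((hχ _ _).1 h₁) ((hχ _ _).1 h₂)

/-- If each `g i` lies in all the other subgroups, the cosets `g i * H i` have the finite intersection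
property. -/
theorem exists_mul_mem {G ι : Type*} [Group G] {H : ι → Subgroup G} (hnormal : ∀ i, (H i).Normal)
    {g : ι → G} (hg : ∀ i j, i ≠ j → g i ∈ H j) (s : Finset ι) :
    ∃ x, (∀ i ∈ s, (g i)⁻¹ * x ∈ H i) ∧ ∀ i ∉ s, x ∈ H i := by
  classical
  induction s using Finset.induction_on with
  | empty => exact ⟨1, by simp, fun i _ => (H i).one_mem⟩
  | insert j s hj ih =>
    obtain ⟨x, hx, hx'⟩ := ih
    refine ⟨x * g j, fun i hi => ?_, fun i hi => ?_⟩
    · rcases Finset.mem_insert.1 hi with rfl | hi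
      · simpa [mul_assoc] using (hnormal i).conj_mem x (hx' i hj) (g i)⁻¹
      · rw [← mul_assoc]
        exact (H i).mul_mem (hx i hi) (hg j i fun h => hj (h ▸ hi))
    · rw [Finset.mem_insert, not_or] at hi
      exact (H i).mul_mem (hx' i hi.2) (hg j i (Ne.symm hi.1))

theorem hasInpArray_of_not_boundedIndex {T : L.Theory} [Nonempty M] [M ⊨ T]
    (hM : IsMonster L M κ) (hG : IsTypeDefinableGroup L κ G) {ι : Type} {H K : ι → Subgroup G}
    (hnormal : ∀ i, (H i).Normal) (hH : ∀ i, IsTypeDefinableSubgroup L κ (H i))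
    (hKH : ∀ i j, i ≠ j → K i ≤ H j) (hK : ∀ i, ¬ BoundedIndex κ (K i) (H i)) :
    T.HasInpArray n ι := by
  choose χ g a hgK hχ hdisj using fun i => exists_row hM hG (hH i) (hK i)
  have harr : IsInpArray χ (fun _ => 2) a := by
    refine ⟨fun α s hs => ?_, fun f s => ?_⟩
    · rintro ⟨x, hx⟩
      obtain ⟨i, j, hij, rfl⟩ := Finset.card_eq_two.1 hs
      rcases hij.lt_or_gt with hij | hij
      · exact hdisj α i j hij ⟨x, hx i (by simp), hx j (by simp)⟩
      · exact hdisj α j i hij ⟨x, hx j (by simp), hx i (by simp)⟩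
    · obtain ⟨x, hx, -⟩ := exists_mul_mem hnormal (g := fun i => g i (f i))
        (fun i j hij => hKH i j hij (hgK i (f i))) s
      refine ⟨x, fun α hα => ?_⟩
      simpa using hχ α (f α) _ (hx α hα)
  obtain ⟨N, b, hb⟩ := Theory.exists_isInpArray_of_finite (T := T) (M := M) χ (fun _ => 2)
    fun F m => ⟨a, fun α _ s _ => harr.inconsistent α s, fun f _ => harr.consistent f F⟩
  exact ⟨N, ℕ, χ, _, b, hb⟩

end Row

end FirstOrder.Language

theorem proposition4p5 {L : FirstOrder.Language.{u, v}} (T : L.Theory) (hT : T.IsComplete)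
    (κ : Cardinal.{w}) (M : Type w) [L.Structure M] [Nonempty M] (hMT : M ⊨ T)
    (hM : FirstOrder.Language.IsMonster L M κ)
    {n : ℕ} (G : Set (Fin n → M)) [Group G]
    (hG : FirstOrder.Language.IsTypeDefinableGroup L κ G)
    (H : ℕ → Subgroup G) (hnormal : ∀ i, (H i).Normal)
    (hH : ∀ i, FirstOrder.Language.IsTypeDefinableSubgroup L κ (H i)) :
    (T.IsStrong → ∃ i₀ : ℕ,
      FirstOrder.Language.BoundedIndex κ (⨅ (i : ℕ) (_ : i ≠ i₀), H i) (⨅ i : ℕ, H i)) ∧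
    (T.HasFiniteBurden → ∃ m : ℕ, ∃ i₀ < m,
      FirstOrder.Language.BoundedIndex κ (⨅ (i : ℕ) (_ : i < m) (_ : i ≠ i₀), H i)
        (⨅ (i : ℕ) (_ : i < m), H i)) := by
  constructor
  · intro hstrong
    by_contra! hcon
    refine hstrong.not_hasInpArray n (FirstOrder.Language.hasInpArray_of_not_boundedIndex hM hG
      (K := fun i₀ => ⨅ (i : ℕ) (_ : i ≠ i₀), H i) hnormal hH
      (fun i j hij => iInf₂_le j hij.symm) fun i₀ hb => hcon i₀ ?_)
    have : (⨅ i, H i).subgroupOf (⨅ (i : ℕ) (_ : i ≠ i₀), H i) =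
        (H i₀).subgroupOf (⨅ (i : ℕ) (_ : i ≠ i₀), H i) := by
      ext ⟨x, hx⟩
      simp only [Subgroup.mem_subgroupOf, Subgroup.mem_iInf] at hx ⊢
      exact ⟨fun h => h i₀, fun h i => by
        by_cases hi : i = i₀
        · exact hi ▸ h
        · exact hx i hi⟩
    rwa [FirstOrder.Language.BoundedIndex, this]
  · rintro ⟨b, hb⟩
    by_contra! hcon
    refine hb.not_hasInpArray n (FirstOrder.Language.hasInpArray_of_not_boundedIndex hM hG
      (H := fun i : Fin ((b + 1) ^ n) => H i)
      (K := fun i₀ => ⨅ (i : ℕ) (_ : i < (b + 1) ^ n) (_ : i ≠ i₀), H i)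
      (fun i => hnormal i) (fun i => hH i)
      (fun i j hij => iInf_le_of_le (j : ℕ) (iInf₂_le j.2 fun h => hij (Fin.ext h.symm)))
      fun i₀ hb => hcon _ i₀ i₀.2 ?_)
    have : (⨅ (i : ℕ) (_ : i < (b + 1) ^ n), H i).subgroupOf
        (⨅ (i : ℕ) (_ : i < (b + 1) ^ n) (_ : i ≠ i₀), H i) =
        (H i₀).subgroupOf (⨅ (i : ℕ) (_ : i < (b + 1) ^ n) (_ : i ≠ i₀), H i) := by
      ext ⟨x, hx⟩
      simp only [Subgroup.mem_subgroupOf, Subgroup.mem_iInf] at hx ⊢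
      exact ⟨fun h => h i₀ i₀.2, fun h i hin => by
        by_cases hi : i = i₀
        · exact hi ▸ h
        · exact hx i hin hi⟩
    rwa [FirstOrder.Language.BoundedIndex, this]
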